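/- Let $\mathrm{Homeo}(2^{\mathbb N})$ be the group of homeomorphisms of the Cantor space $2^{\mathbb N}$ with the topology of uniform convergence, given by the metric $\tilde d(f,g)=\max_\sigma d(f(\sigma),g(\sigma))$, where $d$ is a compatible metric on $2^{\mathbb N}$. For a sequence $\alpha=(\alpha(1),\alpha(2),\dots)$ of integers $\ge 2$, the odometer $f_\alpha$ is the map $x\mapsto x+(1,0,0,\dots)$ on the product $\Delta_\alpha=\prod_{i\ge1}\{0,\dots,\alpha(i)-1\}$ of finite discrete spaces, where $+$ is coordinatewise addition modulo $\alpha(i)$ with carry to the right. It is called universal if, for every prime $p$, $\sum_{i\ge1} n_p(i)=\infty$, where $n_p(i)$ is the largest integer $n$ with $p^{n}\mid\alpha(i)$. (Any two universal odometers are topologically conjugate, so one speaks of the universal odometer.) Theorem. Let $h$ be an element of the comeager conjugacy class of $\mathrm{Homeo}(2^{\mathbb N})$, that is, of the conjugacy class of this group that is a comeager subset of it. Then for every $\sigma\in 2^{\mathbb N}$ the restriction of $h$ to the $\omega$-limit set $\omega(\sigma,h)$ (the set of all limit points of the sequence $(h^n(\sigma))_{n\in\mathbb N}$) is topologically conjugate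 to the universal odometer: for every universal odometer $f_\alpha$ there is a homeomorphism $\varphi:\omega(\sigma,h)\to\Delta_\alpha$ with $\varphi\circ h=f_\alpha\circ\varphi$ on $\omega(\sigma,h)$. -/

import Mathlib

open Set Filter Topology

/-- The Cantor space `2^ℕ` with the product topology. -/
abbrev Cantor : Type := ℕ → Bool

/-- The topology on `Homeo(2^ℕ)` of uniform convergence. It is induced from the compact-open
topology on `C(2^ℕ, 2^ℕ)`, which, `2^ℕ` being compact, is the topology of the metric
`sup_σ d(f σ, g σ)` for every compatible metric `d` on `2^ℕ`. -/
instance homeoCantorTopology : TopologicalSpace (Cantor ≃ₜ Cantor) :=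
  TopologicalSpace.induced (fun h => (⟨h, h.continuous⟩ : C(Cantor, Cantor))) inferInstance

/-- Two self-maps of topological spaces are topologically conjugate. -/
def TopConjugate {X Y : Type*} [TopologicalSpace X] [TopologicalSpace Y]
    (f : X → X) (g : Y → Y) : Prop :=
  ∃ φ : X ≃ₜ Y, Function.Semiconj φ f g

/-- The `ω`-limit set of `f` at `x`: the set of limit (cluster) points of the sequence
`x, f x, f (f x), …`. -/
def omegaLimitSet {X : Type*} [TopologicalSpace X] (f : X → X) (x : X) : Set X :=
  omegaLimit atTop (fun (n : ℕ) (y : X) => f^[n] y) {x}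

theorem mem_omegaLimitSet {X : Type*} [TopologicalSpace X] {f : X → X} {x y : X} :
    y ∈ omegaLimitSet f x ↔ MapClusterPt y atTop (fun n : ℕ => f^[n] x) :=
  mem_omegaLimit_singleton_iff_mapClusterPt _ _ _ _

theorem mapsTo_omegaLimitSet {X : Type*} [TopologicalSpace X] {f : X → X} (hf : Continuous f)
    (x : X) : MapsTo f (omegaLimitSet f x) (omegaLimitSet f x) := by
  intro y hy
  rw [mem_omegaLimitSet] at hy ⊢
  have h1 : MapClusterPt (f y) atTop (f ∘ fun n : ℕ => f^[n] x) :=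
    hy.continuousAt_comp hf.continuousAt
  have h2 : (f ∘ fun n : ℕ => f^[n] x) = (fun n : ℕ => f^[n] x) ∘ (fun n => n + 1) := by
    funext n
    exact (Function.iterate_succ_apply' f n x).symm
  rw [h2] at h1
  exact MapClusterPt.of_comp (tendsto_add_atTop_nat 1) h1

/-- The restriction of a homeomorphism `h` of `2^ℕ` to its `ω`-limit set at `σ`. -/
def restrictOmega (h : Cantor ≃ₜ Cantor) (σ : Cantor) :
    omegaLimitSet h σ → omegaLimitSet h σ :=
  (mapsTo_omegaLimitSet h.continuous σ).restrict h (omegaLimitSet h σ) (omegaLimitSet h σ)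

/-- The product `∏ i, {0, …, α i - 1}` of finite discrete spaces. -/
abbrev OdometerSpace (α : ℕ → ℕ) : Type := ∀ i, Fin (α i)

/-- The carry into the digit `i` in the sum of `x` and `y`. -/
def odometerCarry {α : ℕ → ℕ} (x y : OdometerSpace α) : ℕ → ℕ
  | 0 => 0
  | i + 1 => if (x i : ℕ) + (y i : ℕ) + odometerCarry x y i < α i then 0 else 1

/-- Addition with carry to the right. -/
def odometerAdd {α : ℕ → ℕ} (x y : OdometerSpace α) : OdometerSpace α :=
  fun i => ⟨((x i : ℕ) + (y i : ℕ) + odometerCarry x y i) % α i, Nat.mod_lt _ (x i).pos⟩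

/-- The element `(1, 0, 0, …)`. -/
def odometerOne {α : ℕ → ℕ} (hα : ∀ i, 2 ≤ α i) : OdometerSpace α :=
  fun i => ⟨if i = 0 then 1 else 0, by have := hα i; split <;> omega⟩

/-- The odometer (adding machine) `x ↦ x + (1, 0, 0, …)`. -/
def odometer {α : ℕ → ℕ} (hα : ∀ i, 2 ≤ α i) (x : OdometerSpace α) : OdometerSpace α :=
  odometerAdd x (odometerOne hα)

/-- The sum over all `i` of the exponents of `p` in `α i`, with values in `{0, 1, 2, …, ∞}`. -/
noncomputable def odometerMult (α : ℕ → ℕ) (p : ℕ) : ℕ∞ :=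
  ⨆ n : ℕ, ((∑ i ∈ Finset.range n, padicValNat p (α i) : ℕ) : ℕ∞)

/-- The condition on `α` under which its odometer is called universal. -/
def IsUniversalBase (α : ℕ → ℕ) : Prop :=
  ∀ p : ℕ, p.Prime → odometerMult α p = ⊤

/-- Universal odometers exist: `α = (2, 3, 4, …)` is an example. -/
theorem isUniversalBase_add_two : IsUniversalBase (fun i => i + 2) := by
  intro p hp
  have : Fact p.Prime := ⟨hp⟩
  rw [odometerMult, ENat.eq_top_iff_forall_ge]
  intro m
  refine le_trans ?_ (le_iSup _ (p ^ m))
  have h0 : p ^ m - 2 + 2 = p ^ m ∨ m = 0 := by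
    rcases Nat.eq_zero_or_pos m with h | h
    · exact Or.inr h
    · left
      have h1 := Nat.pow_le_pow_left hp.two_le m
      have h2 := Nat.pow_le_pow_right (n := 2) (by norm_num) h
      omega
  rcases h0 with h | rfl
  · have hpos : 0 < p ^ m := pow_pos hp.pos m
    have hmem : p ^ m - 2 ∈ Finset.range (p ^ m) := by
      rw [Finset.mem_range]; omega
    have := Finset.single_le_sum (f := fun i => padicValNat p (i + 2))
      (fun i _ => Nat.zero_le _) hmem
    simp only [h, padicValNat.prime_pow] at this
    exact_mod_cast this
  · simp

/-! Call a homeomorphism good if for all `n` and all `m > 0` some finite clopen partition, finer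
than the cylinders of length `n`, induces a digraph in which every infinite walk ends up going round
a cycle of length divisible by `m`. Goodness is generic. Each condition is open, since it depends
only on the digraph. It is dense (`exists_cyclicHomeos_near`): `f` can be altered inside small
cylinders so that the digraph becomes a disjoint union of dumbbells, two `N`-cycles joined by a
path. As the group is Baire, the comeager class contains a good element, and conjugation carries
ω-limit sets along. For good `h`, the late points of an orbit share a colour exactly when their
times agree mod `N`, while odometer iterates of zero share `j` digits exactly when the times agree
mod `baseProd α j`. Choosing `m = baseProd α j` makes `N` a multiple of it; universality makes each
`N` divide some `baseProd α j`. So in a limit point of the joint orbit each coordinate determines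
the other, and these limit points form the graph of the conjugacy. -/

/-! ### Clopen partitions and cylinders. -/

section CantorTopology

/-- A compact subset of an open subset of the Cantor space is contained in it together with all
cylinders of some fixed length around its points. -/
theorem exists_cylinder_subset_of_isCompact {K U : Set Cantor} (hK : IsCompact K) (hU : IsOpen U)
    (hKU : K ⊆ U) : ∃ n : ℕ, ∀ x ∈ K, ∀ y : Cantor, (∀ i < n, y i = x i) → y ∈ U := by
  have key : ∀ x ∈ K, ∃ n, PiNat.cylinder x n ⊆ U := by
    intro x hx
    obtain ⟨v, ⟨z, n, rfl⟩, hxv, hvU⟩ :=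
      (PiNat.isTopologicalBasis_cylinders (fun _ : ℕ => Bool)).exists_subset_of_mem_open
        (hKU hx) hU
    exact ⟨n, (PiNat.mem_cylinder_iff_eq.1 hxv).symm ▸ hvU⟩
  choose! m hm using key
  obtain ⟨t, htK, hKt⟩ := hK.elim_nhds_subcover (fun x => PiNat.cylinder x (m x))
    (fun x _ => (PiNat.isOpen_cylinder _ x (m x)).mem_nhds (PiNat.self_mem_cylinder x _))
  refine ⟨t.sup m, fun x hx y hy => ?_⟩
  obtain ⟨z, hz, hxz⟩ := mem_iUnion₂.1 (hKt hx)
  refine hm z (htK z hz) fun i hi => ?_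
  rw [hy i (hi.trans_le (Finset.le_sup hz)), hxz i hi]

/-- A locally constant function on the Cantor space depends on finitely many coordinates. -/
theorem IsLocallyConstant.exists_forall_eq {ι : Type*} [Finite ι] {q : Cantor → ι}
    (hq : IsLocallyConstant q) : ∃ n : ℕ, ∀ x y : Cantor, (∀ i < n, y i = x i) → q y = q x := by
  have key : ∀ i : ι, ∃ n : ℕ, ∀ x ∈ q ⁻¹' {i}, ∀ y : Cantor, (∀ j < n, y j = x j) →
      y ∈ q ⁻¹' {i} := fun i =>
    exists_cylinder_subset_of_isCompact (hq.isClosed_fiber i).isCompact (hq.isOpen_fiber i)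
      subset_rfl
  choose m hm using key
  obtain ⟨n, hn⟩ := (Set.finite_range m).bddAbove
  exact ⟨n, fun x y hxy => hm (q x) x rfl y
    fun j hj => hxy j (hj.trans_le (hn (mem_range_self _)))⟩

theorem isLocallyConstant_restrict (n : ℕ) :
    IsLocallyConstant (fun (x : Cantor) (i : Fin n) => x i) :=
  IsLocallyConstant.iff_continuous _ |>.2 (by fun_prop)

end CantorTopology

/-! ### The homeomorphism group as a Baire space. -/

section HomeoTopology

theorem continuous_homeo_toContinuousMap :
    Continuous (fun h : Cantor ≃ₜ Cantor => (⟨h, h.continuous⟩ : C(Cantor, Cantor))) :=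
  continuous_induced_dom

/-- `h⁻¹` maps `K` into `U` iff `h` maps `Uᶜ`, which is compact, into `Kᶜ`, which is open. -/
theorem continuous_homeo_symm : Continuous
    (fun h : Cantor ≃ₜ Cantor => (⟨h.symm, h.symm.continuous⟩ : C(Cantor, Cantor))) := by
  rw [ContinuousMap.continuous_compactOpen]
  intro K hK U hU
  have h1 : IsOpen {f : C(Cantor, Cantor) | MapsTo f Uᶜ Kᶜ} :=
    ContinuousMap.isOpen_setOfPred_mapsTo hU.isClosed_compl.isCompact hK.isClosed.isOpen_compl
  convert h1.preimage continuous_homeo_toContinuousMap using 1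
  ext h
  constructor
  · intro H x hx hK
    exact hx (by simpa using H hK)
  · intro H x hx
    by_contra hU
    exact H hU (by simpa using hx)

/-- Homeomorphisms of the Cantor space, as pairs of mutually inverse maps, form a closed set. -/
theorem isClosedEmbedding_homeo : IsClosedEmbedding (fun h : Cantor ≃ₜ Cantor =>
    ((⟨h, h.continuous⟩, ⟨h.symm, h.symm.continuous⟩) : C(Cantor, Cantor) × C(Cantor, Cantor))) := by
  have hcont := continuous_homeo_toContinuousMap.prodMk continuous_homeo_symm
  refine ⟨⟨⟨le_antisymm hcont.le_induced ?_⟩, ?_⟩, ?_⟩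
  · change _ ≤ TopologicalSpace.induced _ _
    have : (fun h : Cantor ≃ₜ Cantor => (⟨h, h.continuous⟩ : C(Cantor, Cantor))) =
      Prod.fst ∘ (fun h : Cantor ≃ₜ Cantor => ((⟨h, h.continuous⟩, ⟨h.symm, h.symm.continuous⟩) :
        C(Cantor, Cantor) × C(Cantor, Cantor))) := rfl
    rw [this, ← induced_compose]
    exact induced_mono continuous_fst.le_induced
  · intro f g hfg
    ext1 x
    exact DFunLike.congr_fun (congrArg Prod.fst hfg) x
  · have : range (fun h : Cantor ≃ₜ Cantor => ((⟨h, h.continuous⟩, ⟨h.symm, h.symm.continuous⟩) :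
        C(Cantor, Cantor) × C(Cantor, Cantor))) =
        {p | p.1.comp p.2 = ContinuousMap.id _} ∩ {p | p.2.comp p.1 = ContinuousMap.id _} := by
      ext p
      constructor
      · rintro ⟨h, rfl⟩
        exact ⟨by ext1 x; exact h.apply_symm_apply x, by ext1 x; exact h.symm_apply_apply x⟩
      · rintro ⟨h1, h2⟩
        exact ⟨⟨⟨p.1, p.2, fun x => DFunLike.congr_fun h2 x, fun x => DFunLike.congr_fun h1 x⟩,
          p.1.continuous, p.2.continuous⟩, rfl⟩
    rw [this]
    exact (isClosed_eq (continuous_fst.compCM continuous_snd) continuous_const).inter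
      (isClosed_eq (continuous_snd.compCM continuous_fst) continuous_const)

theorem isCompletelyMetrizableSpace_continuousMap (X Y : Type*) [TopologicalSpace X]
    [CompactSpace X] [TopologicalSpace Y] [TopologicalSpace.IsCompletelyMetrizableSpace Y] :
    TopologicalSpace.IsCompletelyMetrizableSpace C(X, Y) := by
  let _ := TopologicalSpace.upgradeIsCompletelyMetrizable Y
  infer_instance

instance baireSpace_homeo : BaireSpace (Cantor ≃ₜ Cantor) := by
  have := isCompletelyMetrizableSpace_continuousMap Cantor Cantor
  have := isClosedEmbedding_homeo.IsCompletelyMetrizableSpace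
  infer_instance

/-- One compact-open condition for each of the finitely many clopen fibres of `c ∘ g`. -/
theorem isOpen_setOf_forall_eq {ι : Type*} [Finite ι] {c : Cantor → ι} (hc : IsLocallyConstant c)
    (g : Cantor ≃ₜ Cantor) : IsOpen {h : Cantor ≃ₜ Cantor | ∀ x, c (h x) = c (g x)} := by
  have h1 : ∀ i : ι, IsOpen {f : C(Cantor, Cantor) | MapsTo f ((c ∘ g) ⁻¹' {i}) (c ⁻¹' {i})} :=
    fun i => ContinuousMap.isOpen_setOfPred_mapsTo
      ((hc.comp_continuous g.continuous).isClosed_fiber i).isCompact (hc.isOpen_fiber i)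
  convert (isOpen_iInter_of_finite h1).preimage continuous_homeo_toContinuousMap using 1
  ext h
  constructor
  · intro H
    refine mem_iInter.2 fun i x hx => ?_
    exact (H x).trans hx
  · intro H x
    exact mem_iInter.1 H (c (g x)) (rfl : x ∈ (c ∘ g) ⁻¹' {c (g x)})

theorem tendsto_homeo_of_forall_eq {g : ℕ → (Cantor ≃ₜ Cantor)} {f : Cantor ≃ₜ Cantor}
    (hg : ∀ n x, ∀ i < n, g n x i = f x i) : Tendsto g atTop (𝓝 f) := by
  rw [nhds_induced, tendsto_comap_iff, ContinuousMap.tendsto_nhds_compactOpen]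
  intro K hK U hU hKU
  obtain ⟨n, hn⟩ := exists_cylinder_subset_of_isCompact (hK.image f.continuous) hU hKU.image_subset
  filter_upwards [eventually_ge_atTop n] with m hm x hx
  exact hn (f x) (mem_image_of_mem f hx) _ fun i hi => hg m x i (hi.trans_le hm)

end HomeoTopology

/-! ### Cutting the Cantor space into copies of itself. -/

section Splitting

/-- The Cantor space is the disjoint union of its cylinders of length `n`, all of them copies of
the Cantor space. -/
def cantorSplit (n : ℕ) : Cantor ≃ₜ (Fin n → Bool) × Cantor where
  toFun x := (fun i => x i, fun k => x (n + k))
  invFun p k := if h : k < n then p.1 ⟨k, h⟩ else p.2 (k - n)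
  left_inv x := by
    funext k
    by_cases h : k < n
    · simp [h]
    · simp [h, Nat.add_sub_cancel' (not_lt.1 h)]
  right_inv p := by
    ext i
    · simp
    · simp
  continuous_toFun := by fun_prop
  continuous_invFun := by
    refine continuous_pi fun k => ?_
    by_cases h : k < n
    · simp only [h, dif_pos]; fun_prop
    · simp only [h, dif_neg, not_false_eq_true]; fun_prop

/-- Replacing the first factor along a bijection of discrete spaces. -/
def prodCantorCongr {F G : Type*} (e : F ≃ G) [TopologicalSpace F] [DiscreteTopology F]
    [TopologicalSpace G] [DiscreteTopology G] : F × Cantor ≃ₜ G × Cantor :=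
  (e.toHomeomorphOfDiscrete).prodCongr (Homeomorph.refl _)

theorem nonempty_homeomorph_bool_prod : Nonempty (Bool × Cantor ≃ₜ Cantor) :=
  ⟨(prodCantorCongr (Equiv.funUnique (Fin 1) Bool).symm).trans (cantorSplit 1).symm⟩

theorem nonempty_homeomorph_fin_prod (n : ℕ) : Nonempty (Fin (n + 1) × Cantor ≃ₜ Cantor) := by
  induction n with
  | zero => exact ⟨Homeomorph.uniqueProd (Fin 1) Cantor⟩
  | succ n ih =>
    obtain ⟨e⟩ := ih
    obtain ⟨b⟩ := nonempty_homeomorph_bool_prod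
    refine ⟨((prodCantorCongr finSumFinEquiv.symm).trans
      (Homeomorph.sumProdDistrib (X := Fin (n + 1)) (Y := Fin 1) (Z := Cantor))).trans ?_⟩
    refine (e.sumCongr (Homeomorph.uniqueProd (Fin 1) Cantor)).trans ?_
    refine Homeomorph.trans ?_ b
    refine ((Homeomorph.uniqueProd Unit Cantor).symm.sumCongr
      (Homeomorph.uniqueProd Unit Cantor).symm).trans ?_
    exact Homeomorph.sumProdDistrib.symm.trans (prodCantorCongr Equiv.boolEquivPUnitSumPUnit.symm)

theorem nonempty_homeomorph_finite_prod (F : Type*) [Finite F] [Nonempty F] [TopologicalSpace F]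
    [DiscreteTopology F] : Nonempty (F × Cantor ≃ₜ Cantor) := by
  obtain ⟨n, ⟨e⟩⟩ := Finite.exists_equiv_fin F
  obtain _ | n := n
  · exact (e (Classical.arbitrary F)).elim0
  · obtain ⟨h⟩ := nonempty_homeomorph_fin_prod n
    exact ⟨(prodCantorCongr e).trans h⟩

/-- Each fibre of `p` is finite and nonempty, so its product with the Cantor space is again a Cantor
space; these identifications are glued over `I`. -/
theorem exists_homeomorph_over_surjective {J I : Type*} [Finite J] [TopologicalSpace J]
    [DiscreteTopology J] [TopologicalSpace I] [DiscreteTopology I] {p : J → I}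
    (hp : Function.Surjective p) :
    ∃ Φ : J × Cantor ≃ₜ I × Cantor, ∀ z, (Φ z).1 = p z.1 := by
  have key : ∀ i : I, Nonempty ({j // p j = i} × Cantor ≃ₜ Cantor) := fun i =>
    have : Nonempty {j // p j = i} := let ⟨j, hj⟩ := hp i; ⟨⟨j, hj⟩⟩
    nonempty_homeomorph_finite_prod _
  let e := fun i => (key i).some
  have aux : ∀ i (w : {j // p j = i} × Cantor), e (p w.1.1) (⟨w.1.1, rfl⟩, w.2) = e i w := by
    rintro _ ⟨⟨j, rfl⟩, d⟩
    rfl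
  refine ⟨⟨⟨fun z => (p z.1, e (p z.1) (⟨z.1, rfl⟩, z.2)),
    fun w => (((e w.1).symm w.2).1.1, ((e w.1).symm w.2).2), ?_, ?_⟩, ?_, ?_⟩, fun z => rfl⟩
  · rintro ⟨j, c⟩
    simp
  · rintro ⟨i, c⟩
    exact Prod.ext ((e i).symm c).1.2 ((aux i _).trans ((e i).apply_symm_apply c))
  · refine continuous_prod_of_discrete_left.2 fun j => ?_
    dsimp only
    exact continuous_const.prodMk ((e (p j)).continuous.comp (by fun_prop))
  · refine continuous_prod_of_discrete_left.2 fun i => ?_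
    dsimp only
    have := (e i).symm.continuous
    exact (continuous_subtype_val.comp (continuous_fst.comp this)).prodMk
      (continuous_snd.comp this)

/-- A partition of the Cantor space into nonempty clopen sets can be refined into copies of
the Cantor space, with prescribed numbers of pieces. -/
theorem exists_homeomorph_refining {J I : Type} [Finite J] [Finite I] {q : Cantor → I}
    (hq : IsLocallyConstant q) (hqs : Function.Surjective q) {p : J → I}
    (hp : Function.Surjective p) [TopologicalSpace J] [DiscreteTopology J] :
    ∃ Θ : Cantor ≃ₜ J × Cantor, ∀ x, p (Θ x).1 = q x := by
  let _ : TopologicalSpace I := ⊥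
  have : DiscreteTopology I := ⟨rfl⟩
  obtain ⟨n, hn⟩ := hq.exists_forall_eq
  -- `q` factors through the first `n` coordinates; the tail `false` is arbitrary.
  let r : (Fin n → Bool) → I := fun s => q ((cantorSplit n).symm (s, fun _ => false))
  have hr : ∀ x, r (cantorSplit n x).1 = q x := fun x => hn x _ fun i hi => by
    simp [cantorSplit, hi]
  have hrs : Function.Surjective r := fun i => by
    obtain ⟨x, rfl⟩ := hqs i
    exact ⟨_, hr x⟩
  obtain ⟨Φ, hΦ⟩ := exists_homeomorph_over_surjective hrs
  obtain ⟨Ψ, hΨ⟩ := exists_homeomorph_over_surjective hp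
  refine ⟨(cantorSplit n).trans (Φ.trans Ψ.symm), fun x => ?_⟩
  rw [← hΨ, ← hr, ← hΦ]
  simp

end Splitting

/-! ### Walks in finite digraphs and dumbbells. -/

section Dumbbell

theorem exists_iterate_idempotent {V : Type*} [Finite V] (s : V → V) :
    ∃ n, 0 < n ∧ ∀ k, 0 < k → s^[n * k] = s^[n] := by
  obtain ⟨a, b, hab, h⟩ := Finite.exists_ne_map_eq_of_infinite (fun n : ℕ => s^[n])
  wlog hlt : a < b generalizing a b
  · exact this b a hab.symm h.symm (lt_of_le_of_ne (not_lt.1 hlt) hab.symm)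
  obtain ⟨d, rfl⟩ := Nat.exists_eq_add_of_lt hlt
  have h1 : ∀ j, a ≤ j → s^[j + (d + 1)] = s^[j] := by
    intro j hj
    obtain ⟨t, rfl⟩ := Nat.exists_eq_add_of_le' hj
    rw [add_assoc, Function.iterate_add, ← add_assoc, ← h, ← Function.iterate_add]
  have h2 : ∀ t j, a ≤ j → s^[j + (d + 1) * t] = s^[j] := by
    intro t
    induction t with
    | zero => simp
    | succ t ih => 
      intro j hj
      rw [Nat.mul_succ, ← add_assoc, h1 _ (by omega), ih j hj]
  -- A multiple of the period `d + 1` lying beyond the preperiod `a`.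
  refine ⟨(d + 1) * (a + 1), by positivity, fun k hk => ?_⟩
  obtain ⟨k, rfl⟩ := Nat.exists_eq_add_of_lt hk
  have : (d + 1) * (a + 1) * (0 + k + 1) = (d + 1) * (a + 1) + (d + 1) * ((a + 1) * k) := by ring
  rw [this]
  exact h2 _ _ (by nlinarith)

/-- In a finite digraph without sources and sinks, every edge lies in the middle of a walk of
length `4 * N + 1` whose first `N` and last `N` steps are closed. -/
theorem exists_dumbbell_walk {V : Type*} [Finite V] {E : V → V → Prop}
    (hout : ∀ v, ∃ w, E v w) (hin : ∀ w, ∃ v, E v w) {m : ℕ} (hm : 0 < m) :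
    ∃ N, 0 < N ∧ m ∣ N ∧ ∀ v w, E v w → ∃ p : ℕ → V, (∀ i, i ≤ 4 * N → E (p i) (p (i + 1))) ∧
      p N = p 0 ∧ p (4 * N + 1) = p (3 * N + 1) ∧ p (2 * N) = v ∧ p (2 * N + 1) = w := by
  choose s hs using hout
  choose r hr using hin
  obtain ⟨a, ha, hsa⟩ := exists_iterate_idempotent s
  obtain ⟨b, hb, hrb⟩ := exists_iterate_idempotent r
  have hN : 0 < m * a * b := by positivity
  have es : s^[2 * (m * a * b)] = s^[m * a * b] := by
    rw [show 2 * (m * a * b) = a * (2 * m * b) by ring, show m * a * b = a * (m * b) by ring,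
      hsa _ (by positivity), hsa _ (by positivity)]
  have er : r^[2 * (m * a * b)] = r^[m * a * b] := by
    rw [show 2 * (m * a * b) = b * (2 * m * a) by ring, show m * a * b = b * (m * a) by ring,
      hrb _ (by positivity), hrb _ (by positivity)]
  refine ⟨m * a * b, hN, ⟨a * b, by ring⟩, fun v w hvw => ?_⟩
  generalize m * a * b = N at *
  -- Follow chosen predecessors back from `v` and chosen successors on from `w`; idempotence of
  -- `r^[N]` and `s^[N]` closes the two end loops.
  refine ⟨fun i => if i ≤ 2 * N then r^[2 * N - i] v else s^[i - 2 * N - 1] w, ?_, ?_, ?_, ?_, ?_⟩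
  · intro i _
    rcases lt_trichotomy i (2 * N) with h | rfl | h
    · simp only [h.le, if_true, Nat.succ_le_of_lt h]
      rw [show 2 * N - i = (2 * N - (i + 1)) + 1 by omega, Function.iterate_succ_apply']
      exact hr _
    · simpa using hvw
    · simp only [not_le.2 h, if_false, not_le.2 (h.trans (Nat.lt_succ_self i))]
      rw [show i + 1 - 2 * N - 1 = (i - 2 * N - 1) + 1 by omega, Function.iterate_succ_apply']
      exact hs _
  · simp only [show N ≤ 2 * N by omega, if_true, Nat.zero_le, Nat.sub_zero, er]
    rw [show 2 * N - N = N by omega]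
  · simp only [show ¬ 4 * N + 1 ≤ 2 * N by omega, show ¬ 3 * N + 1 ≤ 2 * N by omega, if_false]
    rw [show 4 * N + 1 - 2 * N - 1 = 2 * N by omega, show 3 * N + 1 - 2 * N - 1 = N by omega, es]
  · simp
  · simp

theorem eq_iff_modEq_of_cyclic_steps {N : ℕ} {j : ℕ → ℕ} (hj : ∀ k, j k < N)
    (hstep : ∀ k, j (k + 1) = j k + 1 ∨ (j k + 1 = N ∧ j (k + 1) = 0)) (k l : ℕ) :
    j k = j l ↔ k ≡ l [MOD N] := by
  have h : ∀ k, j k ≡ j 0 + k [MOD N] := by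
    intro k
    induction k with
    | zero => rfl
    | succ k ih =>
      rcases hstep k with h | ⟨h1, h2⟩
      · rw [h, ← add_assoc]; exact ih.add_right 1
      · have := ih.add_right 1
        rw [h1] at this
        rw [h2, ← add_assoc]
        exact (Nat.modEq_zero_iff_dvd.2 dvd_rfl).symm.trans this
  constructor
  · intro hkl
    exact Nat.ModEq.add_left_cancel' (j 0) ((h k).symm.trans (hkl ▸ h l))
  · intro hkl
    exact Nat.ModEq.eq_of_lt_of_lt ((h k).trans ((hkl.add_left _).trans (h l).symm)) (hj k) (hj l)

/-- The position of an infinite walk in a dumbbell is eventually cyclic of period `N`. -/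
theorem exists_eventually_cyclic_of_dumbbell_steps {N : ℕ} {i : ℕ → ℕ}
    (hi : ∀ k, i k < 4 * N + 1)
    (hstep : ∀ k, (i k < 4 * N ∧ i (k + 1) = i k + 1) ∨ (i k = 4 * N ∧ i (k + 1) = 3 * N + 1) ∨
      (i k + 1 = N ∧ i (k + 1) = 0)) :
    ∃ K, ∀ k ≥ K, ∀ l ≥ K, (i k = i l ↔ k ≡ l [MOD N]) := by
  by_cases hA : ∀ k, i k < N
  · refine ⟨0, fun k _ l _ => eq_iff_modEq_of_cyclic_steps hA (fun k => ?_) k l⟩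
    have := hA k; have := hA (k + 1); have := hstep k
    omega
  · push Not at hA
    obtain ⟨k₀, hk₀⟩ := hA
    -- Once the first loop is left, the position advances until it is caught in the last loop.
    have hge : ∀ j, N ≤ i (k₀ + j) ∧ (i k₀ + j ≤ i (k₀ + j) ∨ 3 * N + 1 ≤ i (k₀ + j)) := by
      intro j
      induction j with
      | zero => exact ⟨hk₀, Or.inl le_rfl⟩
      | succ j ih =>
        have := hstep (k₀ + j)
        rw [← add_assoc]
        omega
    have hlast : ∀ k, 3 * N + 1 ≤ i (k₀ + (3 * N + 1) + k) := by
      intro k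
      have := (hge (3 * N + 1 + k)).2
      rw [← add_assoc k₀] at this
      omega
    refine ⟨k₀ + (3 * N + 1), fun k hk l hl => ?_⟩
    obtain ⟨k, rfl⟩ := Nat.exists_eq_add_of_le hk
    obtain ⟨l, rfl⟩ := Nat.exists_eq_add_of_le hl
    have := eq_iff_modEq_of_cyclic_steps (N := N)
      (j := fun k => i (k₀ + (3 * N + 1) + k) - (3 * N + 1))
      (fun k => by have := hi (k₀ + (3 * N + 1) + k); have := hlast k; omega)
      (fun k => by
        have := hstep (k₀ + (3 * N + 1) + k)
        have := hlast k
        have := hlast (k + 1)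
        have := hi (k₀ + (3 * N + 1) + (k + 1))
        rw [← add_assoc _ k 1] at *
        omega) k l
    have h1 := hlast k
    have h2 := hlast l
    constructor
    · intro h
      exact (this.1 (by rw [h])).add_left _
    · intro h
      have := this.2 (Nat.ModEq.add_left_cancel' _ h)
      omega

end Dumbbell

/-! ### Genericity of eventually cyclic behaviour. -/

section Density

/-- Every infinite walk in the digraph that `h` induces on the colours of `c` is eventually
periodic and injective modulo its period, which is a multiple of `m`. -/
def EventuallyCyclic (m : ℕ) {ι : Type} (c : Cantor → ι) (h : Cantor → Cantor) : Prop :=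
  ∀ a : ℕ → ι, (∀ k, ∃ x, c x = a k ∧ c (h x) = a (k + 1)) →
    ∃ N, 0 < N ∧ m ∣ N ∧ ∃ K, ∀ k ≥ K, ∀ l ≥ K, (a k = a l ↔ k ≡ l [MOD N])

/-- The homeomorphisms that act eventually cyclically, with periods divisible by `m`, on some
clopen partition finer than the cylinders of length `n`. -/
def cyclicHomeos (n m : ℕ) : Set (Cantor ≃ₜ Cantor) :=
  {h | ∃ (ι : Type) (_ : Finite ι) (c : Cantor → ι), IsLocallyConstant c ∧
    (∀ x y, c x = c y → ∀ i < n, x i = y i) ∧ EventuallyCyclic m c h}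

theorem isOpen_cyclicHomeos (n m : ℕ) : IsOpen (cyclicHomeos n m) := by
  refine isOpen_iff_mem_nhds.2 fun g hg => ?_
  obtain ⟨ι, _, c, hc, hn, hcyc⟩ := hg
  refine mem_of_superset ((isOpen_setOf_forall_eq hc g).mem_nhds fun _ => rfl) fun h hh => ?_
  refine ⟨ι, inferInstance, c, hc, hn, fun a ha => hcyc a fun k => ?_⟩
  obtain ⟨x, h1, h2⟩ := ha k
  exact ⟨x, h1, (hh x).symm.trans h2⟩

/-- Source of an edge of the dumbbell with vertices `0, …, 4 * N`: the edge `some i` leaves `i`, the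
edge `none` closes the first loop. -/
def dumbbellSource (N : ℕ) : Option (Fin (4 * N + 1)) → Fin (4 * N + 1)
  | some i => i
  | none => ⟨N - 1, by omega⟩

/-- Target of an edge of the dumbbell. -/
def dumbbellTarget (N : ℕ) : Option (Fin (4 * N + 1)) → Fin (4 * N + 1)
  | some i => if h : (i : ℕ) < 4 * N then ⟨i + 1, by omega⟩ else
      -- The default `0` occurs only for `N = 0`.
      if h : 3 * N + 1 < 4 * N + 1 then ⟨3 * N + 1, h⟩ else 0
  | none => 0

theorem dumbbellSource_surjective (N : ℕ) : Function.Surjective (dumbbellSource N) :=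
  fun i => ⟨some i, rfl⟩

theorem dumbbellTarget_surjective (N : ℕ) : Function.Surjective (dumbbellTarget N) := by
  intro i
  by_cases hi : (i : ℕ) = 0
  · exact ⟨none, Fin.ext hi.symm⟩
  · refine ⟨some ⟨i - 1, by omega⟩, Fin.ext ?_⟩
    have : (i : ℕ) - 1 < 4 * N := by omega
    simp only [dumbbellTarget, this, dif_pos]
    omega

theorem dumbbell_step {N : ℕ} (hN : 0 < N) (o : Option (Fin (4 * N + 1))) :
    ((dumbbellSource N o : ℕ) < 4 * N ∧ (dumbbellTarget N o : ℕ) = dumbbellSource N o + 1) ∨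
    ((dumbbellSource N o : ℕ) = 4 * N ∧ (dumbbellTarget N o : ℕ) = 3 * N + 1) ∨
    ((dumbbellSource N o : ℕ) + 1 = N ∧ (dumbbellTarget N o : ℕ) = 0) := by
  rcases o with _ | i
  · right; right
    simp only [dumbbellSource, dumbbellTarget, Fin.val_zero, and_true]
    omega
  · have := i.isLt
    by_cases h : (i : ℕ) < 4 * N
    · left; simp [dumbbellSource, dumbbellTarget, h]
    · right; left
      simp only [dumbbellSource, dumbbellTarget, h, dif_neg, not_false_eq_true,
        show 3 * N + 1 < 4 * N + 1 by omega, dif_pos, and_true]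
      omega

/-- Every transition of `f` between cylinders is an edge in the middle of a dumbbell walk. Take one
dumbbell per transition, label its vertices by the walk, and divide the space into pieces indexed by
all dumbbell edges, compatibly with the transitions of `f`. Sending each edge piece onto a part of
its target vertex gives `g`, which moves cylinders as `f` does. -/
theorem exists_cyclicHomeos_near (f : Cantor ≃ₜ Cantor) {n m : ℕ} (hm : 0 < m) :
    ∃ g ∈ cyclicHomeos n m, ∀ x, ∀ i < n, g x i = f x i := by
  let P : Cantor → (Fin n → Bool) := fun x i => x i
  have hP : IsLocallyConstant P := isLocallyConstant_restrict n
  have hPs : Function.Surjective P := fun s =>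
    ⟨fun k => if h : k < n then s ⟨k, h⟩ else false, by ext i; simp [P]⟩
  let E : (Fin n → Bool) → (Fin n → Bool) → Prop := fun s t => ∃ x, P x = s ∧ P (f x) = t
  obtain ⟨N, hN, hmN, hwalk⟩ := exists_dumbbell_walk (E := E)
    (fun s => by obtain ⟨x, hx⟩ := hPs s; exact ⟨_, x, hx, rfl⟩)
    (fun t => by
      obtain ⟨y, hy⟩ := hPs t
      exact ⟨_, f.symm y, rfl, by rw [f.apply_symm_apply, hy]⟩) hm
  let I := {e : (Fin n → Bool) × (Fin n → Bool) // E e.1 e.2}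
  have hwalk' : ∀ e : I, _ := fun e => hwalk e.1.1 e.1.2 e.2
  choose p hpE hp0 hpN hpv hpw using hwalk'
  let D := I × Option (Fin (4 * N + 1))
  let V := I × Fin (4 * N + 1)
  let src : D → V := fun b => (b.1, dumbbellSource N b.2)
  let tgt : D → V := fun b => (b.1, dumbbellTarget N b.2)
  let lab : V → (Fin n → Bool) := fun v => p v.1 v.2
  have hstep : ∀ b : D, lab (tgt b) = p b.1 (dumbbellSource N b.2 + 1) := by
    rintro ⟨e, o⟩
    rcases dumbbell_step hN o with ⟨-, h⟩ | ⟨h1, h2⟩ | ⟨h1, h2⟩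
    · simp only [lab, tgt, h]
    · simp only [lab, tgt, h1, h2, hpN]
    · simp only [lab, tgt, h1, h2, hp0]
  have hedge : ∀ b : D, E (lab (src b)) (lab (tgt b)) := fun b => by
    rw [hstep]
    exact hpE _ _ (by have := (dumbbellSource N b.2).isLt; omega)
  let q : Cantor → I := fun x => ⟨(P x, P (f x)), x, rfl, rfl⟩
  have hq : IsLocallyConstant q := by
    have h2 : IsLocallyConstant (fun x => (P x, P (f x))) :=
      hP.prodMk (hP.comp_continuous f.continuous)
    exact IsLocallyConstant.desc q Subtype.val h2 Subtype.val_injective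
  have hqs : Function.Surjective q := by
    rintro ⟨⟨s, t⟩, x, hs, ht⟩
    exact ⟨x, Subtype.ext (Prod.ext hs ht)⟩
  let π : D → I := fun b => ⟨(lab (src b), lab (tgt b)), hedge b⟩
  have hπ : Function.Surjective π := by
    intro e
    -- The middle edge of the dumbbell of `e` carries the transition `e` itself.
    refine ⟨(e, some ⟨2 * N, by omega⟩), Subtype.ext (Prod.ext ?_ ?_)⟩
    · exact hpv e
    · exact (hstep _).trans (hpw e)
  let _ : TopologicalSpace D := ⊥
  have : DiscreteTopology D := ⟨rfl⟩
  obtain ⟨Θ, hΘ⟩ := exists_homeomorph_refining hq hqs hπ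
  let v : Cantor → V := fun x => src (Θ x).1
  have hv : IsLocallyConstant v :=
    (IsLocallyConstant.of_discrete src).comp_continuous (continuous_fst.comp Θ.continuous)
  have hvs : Function.Surjective v := by
    rintro ⟨e, i⟩
    obtain ⟨o, rfl⟩ := dumbbellSource_surjective N i
    exact ⟨Θ.symm ((e, o), fun _ => false), by simp [v, src]⟩
  have htgt : Function.Surjective tgt := by
    rintro ⟨e, i⟩
    obtain ⟨o, rfl⟩ := dumbbellTarget_surjective N i
    exact ⟨(e, o), rfl⟩
  -- The vertex partition is cut a second time, now by incoming edges; `g` matches outgoing with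
  -- incoming pieces.
  obtain ⟨Θ', hΘ'⟩ := exists_homeomorph_refining hv hvs htgt
  have hlab : ∀ x, lab (v x) = P x := fun x => congrArg (fun e : I => e.1.1) (hΘ x)
  have hlab' : ∀ x, lab (tgt (Θ x).1) = P (f x) := fun x => congrArg (fun e : I => e.1.2) (hΘ x)
  let g : Cantor ≃ₜ Cantor := Θ.trans Θ'.symm
  have hg : ∀ x, v (g x) = tgt (Θ x).1 := fun x => by
    rw [← hΘ']
    simp [g]
  refine ⟨g, ⟨V, inferInstance, v, hv, fun x y hxy i hi => ?_, fun a ha => ?_⟩, fun x i hi => ?_⟩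
  · have : P x = P y := by rw [← hlab, ← hlab, hxy]
    exact congrFun this ⟨i, hi⟩
  · refine ⟨N, hN, hmN, ?_⟩
    have hb : ∀ k, ∃ b : D, src b = a k ∧ tgt b = a (k + 1) := fun k => by
      obtain ⟨x, h1, h2⟩ := ha k
      exact ⟨(Θ x).1, h1, (hg x).symm.trans h2⟩
    choose b hb1 hb2 using hb
    have hfst : ∀ k, (a k).1 = (a 0).1 := by
      intro k
      induction k with
      | zero => rfl
      | succ k ih => rw [← ih, ← hb1 k, ← hb2 k]
    obtain ⟨K, hK⟩ := exists_eventually_cyclic_of_dumbbell_steps (i := fun k => ((a k).2 : ℕ))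
      (fun k => (a k).2.isLt) (fun k => by
        have := dumbbell_step hN (b k).2
        rw [← hb1 k, ← hb2 k]
        exact this)
    refine ⟨K, fun k hk l hl => ?_⟩
    rw [← hK k hk l hl]
    constructor
    · intro h; rw [h]
    · intro h
      exact Prod.ext ((hfst k).trans (hfst l).symm) (Fin.ext h)
  · have : P (g x) = P (f x) := by rw [← hlab, hg, hlab']
    exact congrFun this ⟨i, hi⟩

theorem dense_cyclicHomeos (n : ℕ) {m : ℕ} (hm : 0 < m) : Dense (cyclicHomeos n m) := by
  intro f
  have h : ∀ L, ∃ g ∈ cyclicHomeos n m, ∀ x, ∀ i < L, g x i = f x i := by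
    intro L
    obtain ⟨g, ⟨ι, hι, c, hc, hn, hcyc⟩, hg⟩ :=
      -- `L` controls the distance to `f`, `n` the fineness of the partition.
      exists_cyclicHomeos_near f (n := max n L) hm
    exact ⟨g, ⟨ι, hι, c, hc, fun x y hxy i hi => hn x y hxy i (hi.trans_le (le_max_left _ _)),
      hcyc⟩, fun x i hi => hg x i (hi.trans_le (le_max_right _ _))⟩
  choose g hg hgf using h
  exact mem_closure_of_tendsto (tendsto_homeo_of_forall_eq hgf) (Eventually.of_forall hg)

theorem residual_cyclicHomeos :
    {h : Cantor ≃ₜ Cantor | ∀ n m, 0 < m → h ∈ cyclicHomeos n m} ∈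
      residual (Cantor ≃ₜ Cantor) := by
  have : ∀ n m, ∀ᶠ h in residual (Cantor ≃ₜ Cantor), 0 < m → h ∈ cyclicHomeos n m := by
    intro n m
    by_cases hm : 0 < m
    · filter_upwards [residual_of_dense_open (isOpen_cyclicHomeos n m) (dense_cyclicHomeos n hm)]
        with h hh _ using hh
    · exact Eventually.of_forall fun h h' => absurd h' hm
  exact eventually_countable_forall.2 fun n => eventually_countable_forall.2 fun m => this n m

end Density

/-! ### Mixed-radix arithmetic of the odometer. -/

section Odometer

/-- The product of the first `j` terms of `α`. -/
def baseProd (α : ℕ → ℕ) (j : ℕ) : ℕ := ∏ i ∈ Finset.range j, α i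

theorem baseProd_zero (α : ℕ → ℕ) : baseProd α 0 = 1 := Finset.prod_range_zero _

theorem baseProd_succ (α : ℕ → ℕ) (j : ℕ) : baseProd α (j + 1) = baseProd α j * α j :=
  Finset.prod_range_succ _ _

theorem baseProd_dvd_baseProd (α : ℕ → ℕ) {i j : ℕ} (h : i ≤ j) : baseProd α i ∣ baseProd α j :=
  Finset.prod_dvd_prod_of_subset _ _ _ (Finset.range_subset_range.2 h)

theorem baseProd_pos {α : ℕ → ℕ} (hα : ∀ i, 2 ≤ α i) (j : ℕ) : 0 < baseProd α j :=
  Finset.prod_pos fun i _ => by have := hα i; omega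

theorem exists_prime_pow_dvd_baseProd {α : ℕ → ℕ} (hu : IsUniversalBase α) {p : ℕ} (hp : p.Prime)
    (n : ℕ) : ∃ j, p ^ n ∣ baseProd α j := by
  have h := hu p hp
  rw [odometerMult, iSup_eq_top] at h
  obtain ⟨j, hj⟩ := h n (ENat.natCast_lt_top n)
  have hj' : n ≤ ∑ i ∈ Finset.range j, padicValNat p (α i) := by exact_mod_cast hj.le
  refine ⟨j, (pow_dvd_pow p hj').trans ?_⟩
  rw [← Finset.prod_pow_eq_pow_sum]
  exact Finset.prod_dvd_prod_of_dvd _ _ fun i _ => pow_padicValNat_dvd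

theorem exists_dvd_baseProd {α : ℕ → ℕ} (hu : IsUniversalBase α) {N : ℕ} (hN : 0 < N) :
    ∃ j, N ∣ baseProd α j := by
  induction N using Nat.recOnPosPrimePosCoprime with
  | zero => omega
  | one => exact ⟨0, one_dvd _⟩
  | prime_pow p n hp _ => exact exists_prime_pow_dvd_baseProd hu hp n
  | coprime a b ha hb hab iha ihb =>
    obtain ⟨i, hi⟩ := iha (by omega)
    obtain ⟨j, hj⟩ := ihb (by omega)
    exact ⟨max i j, hab.mul_dvd_of_dvd_of_dvd
      (hi.trans (baseProd_dvd_baseProd α (le_max_left i j)))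
      (hj.trans (baseProd_dvd_baseProd α (le_max_right i j)))⟩

/-- The zero sequence. -/
def odometerZero {α : ℕ → ℕ} (hα : ∀ i, 2 ≤ α i) : OdometerSpace α :=
  fun i => ⟨0, by have := hα i; omega⟩

theorem odometer_apply_of_digits {α : ℕ → ℕ} (hα : ∀ i, 2 ≤ α i) {x : OdometerSpace α} {k : ℕ}
    (hx : ∀ i, (x i : ℕ) = k / baseProd α i % α i) (i : ℕ) :
    (odometer hα x i : ℕ) = (k + 1) / baseProd α i % α i := by
  -- Counting the added unit as the carry into digit `0` makes the rule uniform: a carry arrives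
  -- exactly where the quotient by `baseProd α i` increases.
  have hc : ∀ i, (odometerOne hα i : ℕ) + odometerCarry x (odometerOne hα) i =
      if baseProd α i ∣ k + 1 then 1 else 0 := by
    intro i
    induction i with
    | zero => simp [odometerOne, odometerCarry, baseProd_zero]
    | succ i ih =>
      have hlt := (x i).isLt
      have h2 := hα i
      have h1 : (odometerOne hα (i + 1) : ℕ) = 0 := by simp [odometerOne]
      rw [h1, zero_add, odometerCarry, add_assoc, ih, baseProd_succ]
      by_cases hd : baseProd α i ∣ k + 1
      · rw [if_pos hd]
        have hk : (k + 1) / baseProd α i = k / baseProd α i + 1 := by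
          rw [Nat.succ_div, if_pos hd]
        have hiff : baseProd α i * α i ∣ k + 1 ↔ ¬ (x i : ℕ) + 1 < α i := by
          rw [← Nat.dvd_div_iff_mul_dvd hd, hk, Nat.dvd_iff_mod_eq_zero, Nat.add_mod, ← hx i,
            Nat.mod_eq_of_lt (show 1 < α i by omega)]
          constructor
          · intro h h'
            rw [Nat.mod_eq_of_lt h'] at h
            omega
          · intro h
            rw [show (x i : ℕ) + 1 = α i by omega, Nat.mod_self]
        by_cases h' : (x i : ℕ) + 1 < α i
        · rw [if_pos h', if_neg (fun h => hiff.1 h h')]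
        · rw [if_neg h', if_pos (hiff.2 h')]
      · rw [if_neg hd, if_pos (by simp),
          if_neg fun h => hd ((Dvd.intro _ rfl).trans h)]
  change ((x i : ℕ) + (odometerOne hα i : ℕ) + odometerCarry x (odometerOne hα) i) % α i = _
  rw [add_assoc, hc, hx, Nat.succ_div, Nat.mod_add_mod]

theorem odometer_iterate_zero {α : ℕ → ℕ} (hα : ∀ i, 2 ≤ α i) (k i : ℕ) :
    ((odometer hα)^[k] (odometerZero hα) i : ℕ) = k / baseProd α i % α i := by
  induction k generalizing i with
  | zero => simp [odometerZero]
  | succ k ih =>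
    rw [Function.iterate_succ_apply']
    exact odometer_apply_of_digits hα ih i

theorem odometer_iterate_eq_iff_modEq {α : ℕ → ℕ} (hα : ∀ i, 2 ≤ α i) (j k l : ℕ) :
    (∀ i < j, (odometer hα)^[k] (odometerZero hα) i = (odometer hα)^[l] (odometerZero hα) i) ↔
      k ≡ l [MOD baseProd α j] := by
  simp only [Fin.ext_iff, odometer_iterate_zero]
  induction j with
  | zero => simp [baseProd_zero, Nat.modEq_one]
  | succ j ih =>
    rw [Nat.forall_lt_succ_right, ih, baseProd_succ]
    constructor
    · rintro ⟨h1, h2⟩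
      rw [Nat.ModEq, Nat.mod_mul, Nat.mod_mul, h2, h1]
    · intro h
      have h1 : k ≡ l [MOD baseProd α j] := h.of_mul_right _
      refine ⟨h1, ?_⟩
      rw [Nat.ModEq, Nat.mod_mul, Nat.mod_mul, h1] at h
      exact Nat.eq_of_mul_eq_mul_left (baseProd_pos hα j) (Nat.add_left_cancel h)

theorem exists_odometer_iterate_eq {α : ℕ → ℕ} (hα : ∀ i, 2 ≤ α i) (x : OdometerSpace α) (j : ℕ) :
    ∃ k, ∀ i < j, (odometer hα)^[k] (odometerZero hα) i = x i := by
  -- The bound on `k` keeps the next digit free in the induction.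
  suffices h : ∃ k, k < baseProd α j ∧ ∀ i < j, k / baseProd α i % α i = x i by
    obtain ⟨k, -, hk⟩ := h
    exact ⟨k, fun i hi => Fin.ext ((odometer_iterate_zero hα k i).trans (hk i hi))⟩
  induction j with
  | zero => exact ⟨0, by simp [baseProd_zero], by simp⟩
  | succ j ih =>
    obtain ⟨k, hk, hx⟩ := ih
    have hpos := baseProd_pos hα j
    refine ⟨k + baseProd α j * x j, ?_, ?_⟩
    · rw [baseProd_succ]
      calc k + baseProd α j * x j < baseProd α j + baseProd α j * x j := by omega
        _ = baseProd α j * (x j + 1) := by ring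
        _ ≤ _ := Nat.mul_le_mul_left _ (x j).isLt
    · rw [Nat.forall_lt_succ_right]
      refine ⟨fun i hi => ?_, ?_⟩
      · obtain ⟨t, ht⟩ := baseProd_dvd_baseProd α (Nat.succ_le_of_lt hi)
        rw [ht, baseProd_succ, mul_assoc, mul_assoc,
          Nat.add_mul_div_left _ _ (baseProd_pos hα i), Nat.add_mul_mod_self_left, hx i hi]
      · rw [Nat.add_mul_div_left _ _ hpos, Nat.div_eq_of_lt hk, zero_add,
          Nat.mod_eq_of_lt (x j).isLt]

theorem mem_omegaLimitSet_odometer_zero {α : ℕ → ℕ} (hα : ∀ i, 2 ≤ α i) (x : OdometerSpace α) :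
    MapClusterPt x atTop (fun k => (odometer hα)^[k] (odometerZero hα)) := by
  rw [mapClusterPt_iff_frequently]
  intro s hs
  obtain ⟨v, ⟨z, j, rfl⟩, hxv, hvs⟩ :=
    (PiNat.isTopologicalBasis_cylinders (fun i : ℕ => Fin (α i))).mem_nhds_iff.1 hs
  obtain ⟨k, hk⟩ := exists_odometer_iterate_eq hα x j
  rw [frequently_atTop]
  intro K
  -- Adding a multiple of `baseProd α j` preserves the first `j` digits.
  refine ⟨k + baseProd α j * K, ?_, hvs fun i hi => ?_⟩
  · have := Nat.le_mul_of_pos_left K (baseProd_pos hα j)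
    omega
  · rw [(odometer_iterate_eq_iff_modEq hα j _ k).2 (by simp [Nat.ModEq]) i hi, hk i hi]
    exact hxv i hi

theorem continuous_odometer {α : ℕ → ℕ} (hα : ∀ i, 2 ≤ α i) : Continuous (odometer hα) := by
  have hcarry : ∀ i, Continuous fun x : OdometerSpace α =>
      odometerCarry x (odometerOne hα) i := by
    intro i
    induction i with
    | zero => exact continuous_const
    | succ i ih =>
      exact (continuous_of_discreteTopology (f := fun p : Fin (α i) × ℕ =>
        if (p.1 : ℕ) + (odometerOne hα i : ℕ) + p.2 < α i then 0 else 1)).comp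
        ((continuous_apply i).prodMk ih)
  refine continuous_pi fun i => ?_
  exact (continuous_of_discreteTopology (f := fun p : Fin (α i) × ℕ =>
    (⟨((p.1 : ℕ) + (odometerOne hα i : ℕ) + p.2) % α i, Nat.mod_lt _ p.1.pos⟩ : Fin (α i)))).comp
    ((continuous_apply i).prodMk (hcarry i))

end Odometer

/-! ### From joint limit points to the conjugacy. -/

section Conjugacy

theorem exists_mapClusterPt_prod {X Y : Type*} [TopologicalSpace X] [TopologicalSpace Y]
    [CompactSpace Y] {u : ℕ → X} (w : ℕ → Y) {x : X} (hx : MapClusterPt x atTop u) :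
    ∃ y, MapClusterPt (x, y) atTop (fun k => (u k, w k)) := by
  obtain ⟨U, hU, hUx⟩ := mapClusterPt_iff_ultrafilter.1 hx
  obtain ⟨y, -, hy⟩ := isCompact_univ.ultrafilter_le_nhds (U.map w) (by simp)
  exact ⟨y, mapClusterPt_iff_ultrafilter.2 ⟨U, hU, hUx.prodMk_nhds hy⟩⟩

/-- If the limit points of the sequence `(f^[k] x, g^[k] y)` are determined by each of their
coordinates and the `ω`-limit set of `y` is the whole space, then the restriction of `f` to the
`ω`-limit set of `x` is conjugate to `g`. -/
theorem topConjugate_of_unique_mapClusterPt {X Y : Type*} [TopologicalSpace X] [CompactSpace X]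
    [T2Space X] [TopologicalSpace Y] [CompactSpace Y] [T2Space Y] {f : X → X} {g : Y → Y}
    (hf : Continuous f) (hg : Continuous g) {x : X} {y : Y} {s : Set X} (hs : s = omegaLimitSet f x)
    (hfs : MapsTo f s s)
    (hy : ∀ b, b ∈ omegaLimitSet g y)
    (h1 : ∀ a b b', MapClusterPt (a, b) atTop (fun k => (f^[k] x, g^[k] y)) →
      MapClusterPt (a, b') atTop (fun k => (f^[k] x, g^[k] y)) → b = b')
    (h2 : ∀ a a' b, MapClusterPt (a, b) atTop (fun k => (f^[k] x, g^[k] y)) →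
      MapClusterPt (a', b) atTop (fun k => (f^[k] x, g^[k] y)) → a = a') :
    TopConjugate (hfs.restrict f s s) g := by
  subst hs
  -- `Z` is the graph of the conjugacy: both projections are continuous bijections from a compact
  -- space.
  let Z : Set (X × Y) := omegaLimitSet (Prod.map f g) (x, y)
  have hiter : (fun k => (Prod.map f g)^[k] (x, y)) = fun k => (f^[k] x, g^[k] y) := by
    funext k
    rw [Prod.map_iterate]
    rfl
  have memZ : ∀ z, z ∈ Z ↔ MapClusterPt z atTop (fun k => (f^[k] x, g^[k] y)) := fun z => by
    rw [mem_omegaLimitSet, hiter]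
  have : CompactSpace Z := isCompact_iff_compactSpace.1 (isClosed_omegaLimit _ _ _).isCompact
  have hfst : ∀ z : Z, z.1.1 ∈ omegaLimitSet f x := fun z =>
    mem_omegaLimitSet.2 (((memZ _).1 z.2).continuousAt_comp continuous_fst.continuousAt)
  let p : Z ≃ omegaLimitSet f x := Equiv.ofBijective (fun z => ⟨z.1.1, hfst z⟩) <| by
    constructor
    · rintro ⟨⟨a, b⟩, hz⟩ ⟨⟨a', b'⟩, hz'⟩ h
      obtain rfl : a = a' := congrArg Subtype.val h
      obtain rfl := h1 a b b' ((memZ _).1 hz) ((memZ _).1 hz')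
      rfl
    · rintro ⟨a, ha⟩
      obtain ⟨b, hb⟩ := exists_mapClusterPt_prod (fun k => g^[k] y) (mem_omegaLimitSet.1 ha)
      exact ⟨⟨(a, b), (memZ _).2 hb⟩, rfl⟩
  let r : Z ≃ Y := Equiv.ofBijective (fun z => z.1.2) <| by
    constructor
    · rintro ⟨⟨a, b⟩, hz⟩ ⟨⟨a', b'⟩, hz'⟩ h
      obtain rfl : b = b' := h
      obtain rfl := h2 a a' b ((memZ _).1 hz) ((memZ _).1 hz')
      rfl
    · intro b
      obtain ⟨a, ha⟩ := exists_mapClusterPt_prod (fun k => f^[k] x) (mem_omegaLimitSet.1 (hy b))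
      exact ⟨⟨(a, b), (memZ _).2 (ha.continuousAt_comp continuous_swap.continuousAt)⟩, rfl⟩
  have hp : Continuous p := by
    change Continuous (fun z : Z => (⟨z.1.1, hfst z⟩ : omegaLimitSet f x))
    fun_prop
  have hr : Continuous r := by
    change Continuous (fun z : Z => z.1.2)
    fun_prop
  refine ⟨hp.homeoOfEquivCompactToT2.symm.trans hr.homeoOfEquivCompactToT2, fun a => ?_⟩
  obtain ⟨z, rfl⟩ := p.surjective a
  have hz := mapsTo_omegaLimitSet (hf.prodMap hg) (x, y) z.2
  have hmap : hfs.restrict f _ _ (p z) = p ⟨_, hz⟩ := rfl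
  rw [hmap]
  change r (p.symm (p _)) = g (r (p.symm (p z)))
  rw [p.symm_apply_apply, p.symm_apply_apply]
  rfl

theorem topConjugate_odometer_of_forall_mem_cyclicHomeos {h : Cantor ≃ₜ Cantor}
    (hcyc : ∀ n m, 0 < m → h ∈ cyclicHomeos n m) (σ : Cantor) {α : ℕ → ℕ} (hα : ∀ i, 2 ≤ α i)
    (hu : IsUniversalBase α) : TopConjugate (restrictOmega h σ) (odometer hα) := by
  have key : ∀ n m, 0 < m → ∃ (ι : Type) (c : Cantor → ι), IsLocallyConstant c ∧
      (∀ x y, c x = c y → ∀ i < n, x i = y i) ∧ ∃ N, 0 < N ∧ m ∣ N ∧ ∃ K, ∀ k ≥ K, ∀ l ≥ K,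
        (c (h^[k] σ) = c (h^[l] σ) ↔ k ≡ l [MOD N]) := by
    intro n m hm
    obtain ⟨ι, _, c, hc, hn, hcyc⟩ := hcyc n m hm
    refine ⟨ι, c, hc, hn, hcyc (fun k => c (h^[k] σ)) fun k => ⟨h^[k] σ, rfl, ?_⟩⟩
    rw [Function.iterate_succ_apply']
  have hfreq : ∀ {a : Cantor} {b : OdometerSpace α},
      MapClusterPt (a, b) atTop (fun k => (h^[k] σ, (odometer hα)^[k] (odometerZero hα))) →
      ∀ {U : Set Cantor} {W : Set (OdometerSpace α)}, U ∈ 𝓝 a → W ∈ 𝓝 b → ∀ K, ∃ k ≥ K,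
        h^[k] σ ∈ U ∧ (odometer hα)^[k] (odometerZero hα) ∈ W := by
    intro a b hab U W hU hW K
    exact frequently_atTop.1 (mapClusterPt_iff_frequently.1 hab _ (prod_mem_nhds hU hW)) K
  refine topConjugate_of_unique_mapClusterPt h.continuous (continuous_odometer hα) rfl _
    (fun b => mem_omegaLimitSet.2 (mem_omegaLimitSet_odometer_zero hα b)) ?_ ?_
  · intro a b b' hb hb'
    funext i
    -- Only divisibility of the period matters here, so fineness `0` suffices.
    obtain ⟨ι, c, hc, -, N, -, hN, K, hK⟩ := key 0 (baseProd α (i + 1)) (baseProd_pos hα _)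
    have hU := (hc.isOpen_fiber (c a)).mem_nhds (rfl : c a = c a)
    have hW : ∀ b : OdometerSpace α, PiNat.cylinder b (i + 1) ∈ 𝓝 b := fun b =>
      (PiNat.isOpen_cylinder _ b (i + 1)).mem_nhds (PiNat.self_mem_cylinder b _)
    obtain ⟨k, hk, hka, hkb⟩ := hfreq hb hU (hW b) K
    obtain ⟨l, hl, hla, hlb⟩ := hfreq hb' hU (hW b') K
    have hkl : k ≡ l [MOD N] := (hK k hk l hl).1 (Eq.trans hka (Eq.symm hla))
    have hi := Nat.lt_succ_self i
    exact (hkb i hi).symm.trans (((odometer_iterate_eq_iff_modEq hα (i + 1) k l).2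
      (hkl.of_dvd hN) i hi).trans (hlb i hi))
  · intro a a' b ha ha'
    funext i
    -- Here only fineness matters; universality absorbs whatever period occurs.
    obtain ⟨ι, c, hc, hi, N, hN0, -, K, hK⟩ := key (i + 1) 1 one_pos
    obtain ⟨j, hj⟩ := exists_dvd_baseProd hu hN0
    have hU : ∀ a : Cantor, PiNat.cylinder a (i + 1) ∈ 𝓝 a := fun a =>
      (PiNat.isOpen_cylinder _ a (i + 1)).mem_nhds (PiNat.self_mem_cylinder a _)
    have hW : PiNat.cylinder b j ∈ 𝓝 b :=
      (PiNat.isOpen_cylinder _ b j).mem_nhds (PiNat.self_mem_cylinder b j)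
    obtain ⟨k, hk, hka, hkb⟩ := hfreq ha (hU a) hW K
    obtain ⟨l, hl, hla, hlb⟩ := hfreq ha' (hU a') hW K
    have hkl : k ≡ l [MOD N] := ((odometer_iterate_eq_iff_modEq hα j k l).1
      fun t ht => (hkb t ht).trans (hlb t ht).symm).of_dvd hj
    have hlt := Nat.lt_succ_self i
    exact (hka i hlt).symm.trans ((hi _ _ ((hK k hk l hl).2 hkl) i hlt).trans (hla i hlt))

theorem topConjugate_restrictOmega_of_semiconj {h h' g : Cantor ≃ₜ Cantor}
    (hg : Function.Semiconj g h h') (σ : Cantor) :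
    TopConjugate (restrictOmega h σ) (restrictOmega h' (g σ)) := by
  have hiter : ∀ k, h'^[k] (g σ) = g (h^[k] σ) := fun k => ((hg.iterate_right k) σ).symm
  have hset : omegaLimitSet h σ = g ⁻¹' omegaLimitSet h' (g σ) := by
    ext y
    simp only [mem_preimage, mem_omegaLimitSet, hiter]
    constructor
    · intro hy
      exact hy.continuousAt_comp g.continuous.continuousAt
    · intro hy
      simpa [Function.comp_def] using hy.continuousAt_comp g.symm.continuous.continuousAt
  exact ⟨g.sets hset, fun y => Subtype.ext (hg y.1)⟩

theorem TopConjugate.trans {X Y Z : Type*} [TopologicalSpace X] [TopologicalSpace Y]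
    [TopologicalSpace Z] {f : X → X} {g : Y → Y} {k : Z → Z} (h₁ : TopConjugate f g)
    (h₂ : TopConjugate g k) : TopConjugate f k := by
  obtain ⟨φ, hφ⟩ := h₁
  obtain ⟨ψ, hψ⟩ := h₂
  exact ⟨φ.trans ψ, hψ.comp_left hφ⟩

end Conjugacy

theorem mainTheorem7 (C : ConjClasses (Cantor ≃ₜ Cantor))
    (hC : C.carrier ∈ residual (Cantor ≃ₜ Cantor))
    (h : Cantor ≃ₜ Cantor) (hh : h ∈ C.carrier) (σ : Cantor)
    (α : ℕ → ℕ) (hα : ∀ i, 2 ≤ α i) (hu : IsUniversalBase α) :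
    TopConjugate (restrictOmega h σ) (odometer hα) := by
  obtain ⟨h', hC', hcyc⟩ :=
    (dense_of_mem_residual (inter_mem hC residual_cyclicHomeos)).nonempty
  obtain ⟨g, hg⟩ := isConj_iff.1 (ConjClasses.mk_eq_mk_iff_isConj.1
    ((ConjClasses.mem_carrier_iff_mk_eq.1 hh).trans (ConjClasses.mem_carrier_iff_mk_eq.1 hC').symm))
  have hsemi : Function.Semiconj g h h' := fun x => by
    rw [← hg]
    exact congrArg (fun y => g (h y)) (g.symm_apply_apply x).symm
  exact (topConjugate_restrictOmega_of_semiconj hsemi σ).trans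
    (topConjugate_odometer_of_forall_mem_cyclicHomeos hcyc (g σ) hα hu)
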